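/- Let $n\ge 0$ be an integer, let $J_{i,j}\ge 0$ ($1\le i,j\le n$) and $h_i\in\mathbb R$ ($1\le i\le n$) be real numbers, and let $\mu$ be the ferromagnetic Ising measure on $\Omega=\{-1,+1\}^n$, $$\mu(\omega)=\frac1Z\exp\Big(\sum_{i,j=1}^n J_{i,j}\,\omega_i\omega_j+\sum_{i=1}^n h_i\,\omega_i\Big),\qquad \omega\in\Omega,$$ where $Z$ is the normalising constant. Let $G$ be the graph with vertex set $[n]=\{1,\dots,n\}$ in which two distinct vertices $i,j$ share an edge iff $J_{i,j}>0$ or $J_{j,i}>0$. For $\omega\in\Omega$, a spin cluster of $\omega$ is a connected component of the graph obtained from $G$ by deleting all vertices $i$ with $\omega_i=-1$, or of the graph obtained from $G$ by deleting all vertices $i$ with $\omega_i=+1$. For $K\subseteq[n]$ let $C(K)=C_\omega(K)$ be the set of all $i\in[n]$ that lie in the same spin cluster of $\omega$ as some $j\in K$, and let $[\omega]_K=\{\alpha\in\Omega:\alpha_i=\omega_i\text{ for all }i\in K\}$. For $A,B\subseteq\Omega$ define $$A\boxminus B=\{\omega\in\Omega:\ \exists\,K,L\subseteq[n]\text{ such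 that } C_\omega(K)\cap C_\omega(L)=\emptyset,\ [\omega]_K\subseteq A\text{ and }[\omega]_L\subseteq B\}.$$ Then, for all $A,B\subseteq\Omega$, $$\mu(A\boxminus B)\le\mu(A)\,\mu(B).$$ -/

import Mathlib

noncomputable section

namespace FerromagneticIsing

/-- The state space `{-1, +1}^n`; the group `ℤˣ` has exactly the two elements `1` and `-1`. -/
abbrev Config (n : ℕ) : Type := Fin n → ℤˣ

/-- The real number `-1` or `+1` that a spin stands for. -/
def spin (s : ℤˣ) : ℝ := ((s : ℤ) : ℝ)

/-- The unnormalised weight `exp (∑_{i,j} J_{ij} ω_i ω_j + ∑_i h_i ω_i)`. -/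
def weight {n : ℕ} (J : Fin n → Fin n → ℝ) (h : Fin n → ℝ) (ω : Config n) : ℝ :=
  Real.exp (∑ i, ∑ j, J i j * spin (ω i) * spin (ω j) + ∑ i, h i * spin (ω i))

/-- The normalising constant `Z`. -/
def partitionFunction {n : ℕ} (J : Fin n → Fin n → ℝ) (h : Fin n → ℝ) : ℝ :=
  ∑ ω : Config n, weight J h ω

/-- The probability `μ(ω)` of a single configuration. -/
def mass {n : ℕ} (J : Fin n → Fin n → ℝ) (h : Fin n → ℝ) (ω : Config n) : ℝ :=
  weight J h ω / partitionFunction J h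

/-- The probability `μ(A) = ∑_{ω ∈ A} μ(ω)` of an event `A`. -/
def prob {n : ℕ} (J : Fin n → Fin n → ℝ) (h : Fin n → ℝ) (A : Set (Config n)) : ℝ :=
  ∑ ω : Config n, A.indicator (mass J h) ω

theorem partitionFunction_pos {n : ℕ} (J : Fin n → Fin n → ℝ) (h : Fin n → ℝ) :
    0 < partitionFunction J h :=
  Finset.sum_pos (fun _ _ => Real.exp_pos _) Finset.univ_nonempty

/-- The masses add up to one, so that `prob` is a probability distribution. -/
theorem prob_univ {n : ℕ} (J : Fin n → Fin n → ℝ) (h : Fin n → ℝ) :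
    prob J h Set.univ = 1 := by
  simp only [prob, Set.indicator_univ, mass, ← Finset.sum_div]
  exact div_self (partitionFunction_pos J h).ne'

/-- The graph on `{1, …, n}` induced by the interaction: distinct vertices `i`, `j` share an edge
iff `J i j > 0` or `J j i > 0` (iff `J i j > 0` when `J` is symmetric). -/
def interactionGraph {n : ℕ} (J : Fin n → Fin n → ℝ) : SimpleGraph (Fin n) :=
  SimpleGraph.fromRel (fun i j => 0 < J i j)

/-- `i` and `j` lie in the same spin cluster of `ω`: for some sign `s`, both have spin `s`, and they
are in the same connected component of the graph that remains when all vertices whose spin is not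
`s` are deleted. -/
def SameSpinCluster {n : ℕ} (J : Fin n → Fin n → ℝ) (ω : Config n) (i j : Fin n) : Prop :=
  ∃ (s : ℤˣ) (hi : ω i = s) (hj : ω j = s),
    ((interactionGraph J).induce {v | ω v = s}).Reachable ⟨i, hi⟩ ⟨j, hj⟩

/-- `C(K)`: all vertices that are in the same spin cluster as some vertex of `K`. -/
def clusterOf {n : ℕ} (J : Fin n → Fin n → ℝ) (ω : Config n) (K : Set (Fin n)) : Set (Fin n) :=
  {i | ∃ j ∈ K, SameSpinCluster J ω i j}

/-- `[ω]_K`: all configurations that agree with `ω` on `K`. -/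
def cylinder {n : ℕ} (ω : Config n) (K : Set (Fin n)) : Set (Config n) :=
  {α | ∀ i ∈ K, α i = ω i}

/-- The event `A ⊟ B` that `A` and `B` occur cluster-disjointly. -/
def clusterBox {n : ℕ} (J : Fin n → Fin n → ℝ) (A B : Set (Config n)) : Set (Config n) :=
  {ω | ∃ K L : Set (Fin n), clusterOf J ω K ∩ clusterOf J ω L = ∅ ∧
    cylinder ω K ⊆ A ∧ cylinder ω L ⊆ B}

end FerromagneticIsing

end

/-! Multiply out by `Z ^ 2` and group pairs of configurations as `(ω, δ * ω)`. For fixed `δ`,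
interactions between vertices with different `δ` cancel, and so do the fields on `{δ = -1}`.
Expanding the remaining ferromagnetic interactions over edge sets `η` gives nonnegative coefficients
times weights invariant under flipping `η`-clusters inside `{δ = -1}`. Each `η`-cluster on which `ω`
is constant lies in one spin cluster, so cluster-disjoint occurrence becomes disjoint occurrence in
the cluster signs `ε`, while `ω ↦ δ * ω` becomes `ε ↦ -ε`. `reimer_inequality` then applies on each
orbit (`card_clusterFlip_clusterBox_le`).

Reimer's inequality is proved by linear algebra: each `x` in the box event gets a vector supported
on its cylinder in `A`. These vectors are independent, and remain so after restriction to `A ∩ -B`,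
whence the cardinality bound. -/

theorem Matrix.det_map_eval {S R : Type*} [Fintype S] [DecidableEq S] [CommRing R]
    (P : Matrix S S (Polynomial R)) (t : R) :
    (P.map (Polynomial.eval t)).det = P.det.eval t :=
  ((Polynomial.evalRingHom t).map_det P).symm

open Finset in
/-- Two matrices of polynomials that specialise to the identity at `0` are invertible at `t` and at
`-1 / t` respectively, for a suitable `t ≠ 0`. -/
theorem exists_parameter_det_ne_zero {S T : Type*} [Fintype S] [DecidableEq S] [Fintype T]
    [DecidableEq T] (P : Matrix S S (Polynomial ℚ)) (R : Matrix T T (Polynomial ℚ))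
    (hP : P.map (Polynomial.eval 0) = 1) (hR : R.map (Polynomial.eval 0) = 1) :
    ∃ t : ℚ, t ≠ 0 ∧ (P.map (Polynomial.eval t)).det ≠ 0 ∧
      (R.map (Polynomial.eval (-t⁻¹))).det ≠ 0 := by
  have hP0 : P.det ≠ 0 := fun h0 => by
    have := Matrix.det_map_eval P 0
    simp [hP, h0] at this
  have hR0 : R.det ≠ 0 := fun h0 => by
    have := Matrix.det_map_eval R 0
    simp [hR, h0] at this
  -- The value `-t⁻¹` is a root `r` exactly when `t = (-r)⁻¹`.
  obtain ⟨t, ht⟩ := Infinite.exists_notMem_finset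
    (insert (0 : ℚ) (P.det.roots.toFinset ∪ R.det.roots.toFinset.image fun r => (-r)⁻¹))
  simp only [mem_insert, mem_union, mem_image, Multiset.mem_toFinset, not_or, not_exists,
    not_and] at ht
  refine ⟨t, ht.1, ?_, ?_⟩
  · rw [Matrix.det_map_eval]
    exact fun h => ht.2.1 ((Polynomial.mem_roots hP0).2 h)
  · rw [Matrix.det_map_eval]
    exact fun h => ht.2.2 (-t⁻¹) ((Polynomial.mem_roots hR0).2 h) (by simp)

/-! ### Reimer's inequality by linear algebra -/

section Reimer

variable {κ : Type*} [Fintype κ] [DecidableEq κ]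

theorem Int.units_eq_neg_of_ne {a b : ℤˣ} (h : a ≠ b) : a = -b :=
  Int.units_ne_iff_eq_neg.1 h

/-- Flipping the coordinate `i` changes the Hamming distance by one. -/
theorem hammingDist_update_neg (x z : κ → ℤˣ) (i : κ) (h : z i = x i) :
    hammingDist x (Function.update z i (-z i)) = hammingDist x z + 1 := by
  have : (Finset.univ.filter fun j => x j ≠ Function.update z i (-z i) j)
      = insert i (Finset.univ.filter fun j => x j ≠ z j) := by
    ext j
    by_cases hj : j = i
    · subst hj
      simp [h, (units_ne_neg_self (x j))]
    · simp [hj]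
  unfold hammingDist
  rw [this, Finset.card_insert_of_notMem (by simp [h])]

/-- The two kernels annihilate each other as soon as some free coordinate `i` of the cylinder of
`x` satisfies `w i = x i`. -/
theorem sum_cylinder_kernel_eq_zero (K : Set κ) [DecidablePred (· ∈ K)] (x w : κ → ℤˣ) (i : κ)
    (hi : i ∉ K) (hw : w i = x i) (t : ℚ) (ht : t ≠ 0) :
    ∑ z : κ → ℤˣ, (if ∀ j ∈ K, z j = x j then (-t⁻¹) ^ hammingDist x z else 0) *
      t ^ hammingDist w z = 0 := by
  have flip : ∀ z : κ → ℤˣ, Function.update (Function.update z i (-z i)) i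
      (-(Function.update z i (-z i)) i) = z := fun z => by simp
  -- Flipping coordinate `i` away from the common value of `x` and `w` multiplies the summand by
  -- `(-t⁻¹) * t = -1`.
  have base : ∀ z : κ → ℤˣ, z i = x i →
      (if ∀ j ∈ K, z j = x j then (-t⁻¹) ^ hammingDist x z else 0) * t ^ hammingDist w z +
      (if ∀ j ∈ K, Function.update z i (-z i) j = x j then
        (-t⁻¹) ^ hammingDist x (Function.update z i (-z i)) else 0) *
        t ^ hammingDist w (Function.update z i (-z i)) = 0 := fun z hz => by
    have hiff : (∀ j ∈ K, Function.update z i (-z i) j = x j) ↔ ∀ j ∈ K, z j = x j := by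
      refine forall₂_congr fun j hj => ?_
      have : j ≠ i := fun h => hi (h ▸ hj)
      simp [this]
    rw [hammingDist_update_neg x z i hz, hammingDist_update_neg w z i (hz.trans hw.symm)]
    simp only [hiff]
    split_ifs
    · rw [pow_succ, pow_succ]
      field_simp
      ring
    · simp
  refine Finset.sum_involution (fun z _ => Function.update z i (-z i)) ?_ ?_
    (fun _ _ => Finset.mem_univ _) (fun z _ => flip z)
  · intro z _
    by_cases hz : z i = x i
    · exact base z hz
    · have hz' : Function.update z i (-z i) i = x i := by
        simp [Int.units_eq_neg_of_ne hz]
      have := base _ hz'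
      rw [flip, add_comm] at this
      exact this
  · intro z _ _ h
    have := congrFun h i
    simp only [Function.update_self] at this
    exact units_ne_neg_self (z i) this.symm

open Classical in
/-- **Reimer's inequality** for the uniform measure on the cube `{-1, 1}^κ`, in its counting form:
the configurations at which `A` and `B` occur disjointly are at most as many as the
configurations `x` with `x ∈ A` and `-x ∈ B`. -/
theorem reimer_inequality (A B : Set (κ → ℤˣ)) :
    (Finset.univ.filter fun x : κ → ℤˣ => ∃ K : Set κ, (∀ y, (∀ i ∈ K, y i = x i) → y ∈ A) ∧
      ∀ y, (∀ i ∉ K, y i = x i) → y ∈ B).card ≤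
    (Finset.univ.filter fun x : κ → ℤˣ => x ∈ A ∧ -x ∈ B).card := by
  set F := Finset.univ.filter fun x : κ → ℤˣ => ∃ K : Set κ,
    (∀ y, (∀ i ∈ K, y i = x i) → y ∈ A) ∧ ∀ y, (∀ i ∉ K, y i = x i) → y ∈ B with hF
  set T := Finset.univ.filter fun x : κ → ℤˣ => x ∈ A ∧ -x ∈ B with hT
  have hK : ∀ x : κ → ℤˣ, ∃ K : Set κ, x ∈ F → (∀ y, (∀ i ∈ K, y i = x i) → y ∈ A) ∧
      ∀ y, (∀ i ∉ K, y i = x i) → y ∈ B := fun x => by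
    by_cases hx : x ∈ F
    · obtain ⟨K, h⟩ := (Finset.mem_filter.1 hx).2
      exact ⟨K, fun _ => h⟩
    · exact ⟨∅, fun h => absurd h hx⟩
  choose K hK using hK
  obtain ⟨t, ht, hU, hM⟩ := exists_parameter_det_ne_zero
    (Matrix.of fun w z : {z : κ → ℤˣ // -z ∉ B} => (Polynomial.X : Polynomial ℚ) ^
      hammingDist w.1 z.1)
    (Matrix.of fun x z : κ → ℤˣ => if ∀ j ∈ K x, z j = x j then
      (Polynomial.X : Polynomial ℚ) ^ hammingDist x z else 0)
    (by
      ext w z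
      by_cases h : w = z
      · subst h
        rw [Matrix.one_apply_eq]
        simp
      · have : hammingDist w.1 z.1 ≠ 0 := fun h0 => h (Subtype.ext (hammingDist_eq_zero.1 h0))
        simp [h, this])
    (by
      ext w z
      by_cases h : w = z
      · subst h
        rw [Matrix.one_apply_eq]
        simp
      · have : hammingDist w z ≠ 0 := fun h0 => h (hammingDist_eq_zero.1 h0)
        simp only [Matrix.map_apply, Matrix.of_apply, Matrix.one_apply_ne h]
        split_ifs <;> simp [this])
  set M : Matrix (κ → ℤˣ) (κ → ℤˣ) ℚ := Matrix.of fun x z =>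
    if ∀ j ∈ K x, z j = x j then (-t⁻¹) ^ hammingDist x z else 0 with hMdef
  set U : Matrix {z : κ → ℤˣ // -z ∉ B} {z : κ → ℤˣ // -z ∉ B} ℚ := Matrix.of fun w z =>
    t ^ hammingDist w.1 z.1 with hUdef
  have hM' : M.det ≠ 0 := by
    convert hM using 2
    ext x z
    simp only [hMdef, Matrix.map_apply, Matrix.of_apply]
    split_ifs <;> simp
  have hU' : U.det ≠ 0 := by
    convert hU using 2
    ext x z
    simp [hUdef]
  let Φ : ((κ → ℤˣ) → ℚ) →ₗ[ℚ] ((κ → ℤˣ) → ℚ) := M.vecMulLinear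
  let ext0 : (F → ℚ) →ₗ[ℚ] ((κ → ℤˣ) → ℚ) := Function.ExtendByZero.linearMap ℚ Subtype.val
  let res : ((κ → ℤˣ) → ℚ) →ₗ[ℚ] (T → ℚ) := LinearMap.funLeft ℚ ℚ Subtype.val
  have hinj : Function.Injective (res ∘ₗ Φ ∘ₗ ext0) := by
    rw [← LinearMap.ker_eq_bot, LinearMap.ker_eq_bot']
    intro c hc
    set e : (κ → ℤˣ) → ℚ := ext0 c with he
    have heF : ∀ x, x ∉ F → e x = 0 := fun x hx => by
      have : ¬ ∃ a : F, a.1 = x := by rintro ⟨a, rfl⟩; exact hx a.2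
      simp only [he, ext0, Function.ExtendByZero.linearMap_apply]
      rw [Function.extend_apply' _ _ _ this]
      rfl
    set v : (κ → ℤˣ) → ℚ := Matrix.vecMul e M with hv
    have hvz : ∀ z, v z = ∑ x, e x * M x z := fun z => rfl
    have hvT : ∀ z ∈ T, v z = 0 := fun z hz => congrFun hc ⟨z, hz⟩
    have hvA : ∀ z, z ∉ A → v z = 0 := fun z hz => by
      rw [hvz]
      refine Finset.sum_eq_zero fun x _ => ?_
      by_cases hx : x ∈ F
      · have : ¬ ∀ j ∈ K x, z j = x j := fun h => hz ((hK x hx).1 z h)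
        simp [hMdef, this]
      · simp [heF x hx]
    have hvB : ∀ z, -z ∈ B → v z = 0 := fun z hz => by
      by_cases hzA : z ∈ A
      · exact hvT z (by simp [hT, hzA, hz])
      · exact hvA z hzA
    -- If `w` differed from `x` at every `i ∉ K x`, then `-w` would agree with `x` there and lie in
    -- `B`; so some free coordinate makes the kernels cancel.
    have horth : ∀ w, -w ∉ B → ∑ z, v z * t ^ hammingDist w z = 0 := fun w hw => by
      simp only [hvz, Finset.sum_mul]
      rw [Finset.sum_comm]
      refine Finset.sum_eq_zero fun x _ => ?_
      by_cases hx : x ∈ F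
      · have : ∃ i, i ∉ K x ∧ w i = x i := by
          by_contra! hcon
          refine hw ((hK x hx).2 _ fun i hi => ?_)
          rw [Pi.neg_apply, Int.units_eq_neg_of_ne (hcon i hi), neg_neg]
        obtain ⟨i, hi, hwi⟩ := this
        simp only [mul_assoc, ← Finset.mul_sum]
        rw [show ∑ z, M x z * t ^ hammingDist w z = 0 from
          sum_cylinder_kernel_eq_zero (K x) x w i hi hwi t ht, mul_zero]
      · simp [heF x hx]
    have hvQ : U.mulVec (fun z => v z.1) = 0 := by
      ext w
      have := horth w.1 w.2
      rw [Pi.zero_apply, ← this, ← Finset.sum_filter_of_ne (s := Finset.univ)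
        (p := fun z => -z ∉ B) (f := fun z => v z * t ^ hammingDist w.1 z)
        (fun z _ hne hz => hne (by rw [hvB z hz, zero_mul])),
        Finset.sum_subtype (p := fun z => -z ∉ B) _ (by simp)]
      exact Finset.sum_congr rfl fun z _ => mul_comm _ _
    have hv0 : v = 0 := by
      have h0 := Matrix.eq_zero_of_mulVec_eq_zero hU' hvQ
      ext z
      by_cases hz : -z ∈ B
      · exact hvB z hz
      · exact congrFun h0 ⟨z, hz⟩
    have he0 : e = 0 := Matrix.eq_zero_of_vecMul_eq_zero hM' hv0
    ext a
    have := congrFun he0 a.1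
    simpa [he, ext0, Function.ExtendByZero.linearMap_apply,
      Subtype.val_injective.extend_apply] using this
  simpa using LinearMap.finrank_le_finrank_of_injective hinj

end Reimer

/-! ### Cluster flips and spin clusters -/

namespace FerromagneticIsing

variable {n : ℕ}

theorem spin_one : spin 1 = 1 := by simp [spin]

theorem spin_neg_one : spin (-1) = -1 := by simp [spin]

theorem spin_mul (s t : ℤˣ) : spin (s * t) = spin s * spin t := by simp [spin]

section ClusterFlip

variable {κ : Type*}

/-- The sign pattern that is `ε (cl i)` at the vertices `i` with `δ i = -1` and `1` elsewhere. -/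
def clusterFlip (δ : Config n) (cl : Fin n → κ) (ε : κ → ℤˣ) : Config n :=
  fun i => if δ i = -1 then ε (cl i) else 1

/-- This turns the condition `δ * ω ∈ B` into the antipodal condition of `reimer_inequality`. -/
theorem mul_clusterFlip (δ : Config n) (cl : Fin n → κ) (ε : κ → ℤˣ) :
    δ * clusterFlip δ cl ε = clusterFlip δ cl (-ε) := by
  ext1 i
  rcases Int.units_eq_one_or (δ i) with h | h <;> simp [clusterFlip, h]

end ClusterFlip

/-- The partition of the vertices into the connected components of the edge set `η`. -/
def edgeSetoid (η : Finset (Fin n × Fin n)) : Setoid (Fin n) :=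
  Relation.EqvGen.setoid fun i j => (i, j) ∈ η

theorem sameSpinCluster_refl (J : Fin n → Fin n → ℝ) (ω : Config n) (i : Fin n) :
    SameSpinCluster J ω i i :=
  ⟨ω i, rfl, rfl, SimpleGraph.Reachable.refl _⟩

theorem sameSpinCluster_symm {J : Fin n → Fin n → ℝ} {ω : Config n} {i j : Fin n}
    (h : SameSpinCluster J ω i j) : SameSpinCluster J ω j i := by
  obtain ⟨s, hi, hj, hr⟩ := h
  exact ⟨s, hj, hi, hr.symm⟩

theorem sameSpinCluster_trans {J : Fin n → Fin n → ℝ} {ω : Config n} {i j k : Fin n}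
    (h : SameSpinCluster J ω i j) (h' : SameSpinCluster J ω j k) : SameSpinCluster J ω i k := by
  obtain ⟨s, hi, hj, hr⟩ := h
  obtain ⟨s', hj', hk, hr'⟩ := h'
  obtain rfl : s = s' := hj.symm.trans hj'
  exact ⟨s, hi, hk, hr.trans hr'⟩

theorem sameSpinCluster_of_edge {J : Fin n → Fin n → ℝ} {ω : Config n} {i j : Fin n}
    (hJ : 0 < J i j) (hω : ω i = ω j) : SameSpinCluster J ω i j := by
  by_cases hij : i = j
  · subst hij
    exact sameSpinCluster_refl J ω i
  · refine ⟨ω j, hω, rfl, SimpleGraph.Adj.reachable ?_⟩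
    simp [interactionGraph, hij, hJ]

theorem sameSpinCluster_of_edgeSetoid {J : Fin n → Fin n → ℝ} {ω : Config n}
    {η : Finset (Fin n × Fin n)} (hη : ∀ p ∈ η, 0 < J p.1 p.2 ∧ ω p.1 = ω p.2) {i j : Fin n}
    (h : edgeSetoid η i j) : SameSpinCluster J ω i j := by
  have h' : Relation.EqvGen (fun i j => (i, j) ∈ η) i j := h
  induction h' with
  | rel i j hij => exact sameSpinCluster_of_edge (hη _ hij).1 (hη _ hij).2
  | refl i => exact sameSpinCluster_refl J ω i
  | symm i j _ ih => exact sameSpinCluster_symm (ih ‹_›)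
  | trans i j k _ _ ih ih' => exact sameSpinCluster_trans (ih ‹_›) (ih' ‹_›)

theorem clusterFlip_eq_of_edge {δ : Config n} {η : Finset (Fin n × Fin n)}
    (hδ : ∀ p ∈ η, δ p.1 = δ p.2) (ε : Quotient (edgeSetoid η) → ℤˣ)
    {p : Fin n × Fin n} (hp : p ∈ η) :
    clusterFlip δ (Quotient.mk (edgeSetoid η)) ε p.1 =
      clusterFlip δ (Quotient.mk (edgeSetoid η)) ε p.2 := by
  have : Quotient.mk (edgeSetoid η) p.1 = Quotient.mk (edgeSetoid η) p.2 :=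
    Quotient.sound (Relation.EqvGen.rel _ _ hp)
  simp only [clusterFlip, hδ p hp, this]

open Classical in
/-- Reimer's inequality on the orbit of `ω` under flipping clusters of `η` in `{δ = -1}`. -/
theorem card_clusterFlip_clusterBox_le (J : Fin n → Fin n → ℝ) (δ ω : Config n)
    (η : Finset (Fin n × Fin n)) (hη : ∀ p ∈ η, 0 < J p.1 p.2) (hδ : ∀ p ∈ η, δ p.1 = δ p.2)
    (hω : ∀ p ∈ η, ω p.1 = ω p.2) (A B : Set (Config n)) :
    (Finset.univ.filter fun ε : Quotient (edgeSetoid η) → ℤˣ =>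
      clusterFlip δ (Quotient.mk _) ε * ω ∈ clusterBox J A B).card ≤
    (Finset.univ.filter fun ε : Quotient (edgeSetoid η) → ℤˣ =>
      clusterFlip δ (Quotient.mk _) ε * ω ∈ A ∧
        δ * (clusterFlip δ (Quotient.mk _) ε * ω) ∈ B).card := by
  set cl : Fin n → Quotient (edgeSetoid η) := Quotient.mk _
  have hR := reimer_inequality {ε | clusterFlip δ cl ε * ω ∈ A} {ε | clusterFlip δ cl ε * ω ∈ B}
  simp only [← mul_assoc, mul_clusterFlip]
  refine (Finset.card_le_card fun ε hε => ?_).trans hR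
  simp only [Finset.mem_filter, Finset.mem_univ, true_and] at hε ⊢
  obtain ⟨K, L, hKL, hKA, hLB⟩ := hε
  have agree : ∀ (ε' : Quotient (edgeSetoid η) → ℤˣ) (i : Fin n), ε' (cl i) = ε (cl i) →
      (clusterFlip δ cl ε' * ω) i = (clusterFlip δ cl ε * ω) i := fun ε' i h => by
    simp only [Pi.mul_apply, clusterFlip, h]
  -- A vertex of `L` whose `η`-cluster meets `K` would lie in both `C(K)` and `C(L)`, so `L` only
  -- uses signs outside `cl '' K`.
  refine ⟨cl '' K, fun ε' h => hKA fun i hi => agree ε' i (h _ ⟨i, hi, rfl⟩),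
    fun ε' h => hLB fun i hi => agree ε' i (h _ ?_)⟩
  rintro ⟨k, hk, hki⟩
  have hsame : SameSpinCluster J (clusterFlip δ cl ε * ω) i k :=
    sameSpinCluster_of_edgeSetoid (η := η) (fun p hp => ⟨hη p hp, by
      rw [Pi.mul_apply, Pi.mul_apply, hω p hp, clusterFlip_eq_of_edge hδ ε hp]⟩)
      (Quotient.exact hki.symm)
  have : i ∈ clusterOf J (clusterFlip δ cl ε * ω) K ∩ clusterOf J (clusterFlip δ cl ε * ω) L :=
    ⟨⟨k, hk, hsame⟩, ⟨i, hi, sameSpinCluster_refl _ _ _⟩⟩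
  rw [hKL] at this
  exact this

open Classical in
/-- Averaging over cluster flips: the inequality for a weight that is the indicator of being
constant on the clusters of `η`, times a function `g` that only depends on the spins in
`{δ = 1}`. -/
theorem sum_constant_on_edges_le (J : Fin n → Fin n → ℝ) (δ : Config n)
    (η : Finset (Fin n × Fin n)) (hη : ∀ p ∈ η, 0 < J p.1 p.2) (hδ : ∀ p ∈ η, δ p.1 = δ p.2)
    (g : Config n → ℝ) (hg0 : ∀ ω, 0 ≤ g ω)
    (hg : ∀ ω ω' : Config n, (∀ i, δ i ≠ -1 → ω i = ω' i) → g ω = g ω') (A B : Set (Config n)) :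
    ∑ ω : Config n, (if ∀ p ∈ η, ω p.1 = ω p.2 then 1 else 0) * g ω *
        (if ω ∈ clusterBox J A B then 1 else 0) ≤
      ∑ ω : Config n, (if ∀ p ∈ η, ω p.1 = ω p.2 then 1 else 0) * g ω *
        (if ω ∈ A ∧ δ * ω ∈ B then 1 else 0) := by
  set cl : Fin n → Quotient (edgeSetoid η) := Quotient.mk _
  have average : ∀ Y : Config n → ℝ,
      ∑ _ε : Quotient (edgeSetoid η) → ℤˣ,
        ∑ ω : Config n, (if ∀ p ∈ η, ω p.1 = ω p.2 then 1 else 0) * g ω * Y ω =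
      ∑ ω : Config n, (if ∀ p ∈ η, ω p.1 = ω p.2 then 1 else 0) * g ω *
        ∑ ε : Quotient (edgeSetoid η) → ℤˣ, Y (clusterFlip δ cl ε * ω) := fun Y => by
    simp only [Finset.mul_sum]
    rw [Finset.sum_comm (s := (Finset.univ : Finset (Config n)))]
    refine Finset.sum_congr rfl fun ε _ => ?_
    -- For fixed `ε` the flip is a bijection of configurations that preserves the weight.
    rw [← Equiv.sum_comp (Equiv.mulLeft (clusterFlip δ cl ε))]
    refine Finset.sum_congr rfl fun ω _ => ?_
    have h1 : g (clusterFlip δ cl ε * ω) = g ω :=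
      hg _ _ fun i hi => by simp [clusterFlip, hi]
    have h2 : (∀ p ∈ η, (clusterFlip δ cl ε * ω) p.1 = (clusterFlip δ cl ε * ω) p.2) ↔
        ∀ p ∈ η, ω p.1 = ω p.2 := forall₂_congr fun p hp => by
      rw [Pi.mul_apply, Pi.mul_apply, clusterFlip_eq_of_edge hδ ε hp, mul_right_inj]
    simp only [Equiv.coe_mulLeft, h1, h2]
  have hcard : (0 : ℝ) < (Finset.univ : Finset (Quotient (edgeSetoid η) → ℤˣ)).card :=
    Nat.cast_pos.2 Finset.univ_nonempty.card_pos
  refine le_of_mul_le_mul_left ?_ hcard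
  rw [← nsmul_eq_mul, ← nsmul_eq_mul, ← Finset.sum_const, ← Finset.sum_const, average, average]
  refine Finset.sum_le_sum fun ω _ => ?_
  by_cases hω : ∀ p ∈ η, ω p.1 = ω p.2
  · refine mul_le_mul_of_nonneg_left ?_ (mul_nonneg (by rw [if_pos hω]; exact zero_le_one) (hg0 ω))
    rw [Finset.sum_boole, Finset.sum_boole]
    exact_mod_cast card_clusterFlip_clusterBox_le J δ ω η hη hδ hω A B
  · simp only [if_neg hω, zero_mul, le_refl]

/-! ### Random-cluster expansion of a pair weight -/

/-- Expansion of the weight of a pair of configurations that differ exactly on `{δ = -1}`. -/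
theorem weight_mul_weight (J : Fin n → Fin n → ℝ) (h : Fin n → ℝ) (δ ω : Config n) :
    weight J h ω * weight J h (δ * ω) =
      (∏ p : Fin n × Fin n, Real.exp (J p.1 p.2 * (1 + spin (δ p.1) * spin (δ p.2)) *
        (spin (ω p.1) * spin (ω p.2)))) * Real.exp (∑ i, h i * (1 + spin (δ i)) * spin (ω i)) := by
  rw [weight, weight, ← Real.exp_sum, ← Real.exp_add, ← Real.exp_add]
  congr 1
  simp only [Fintype.sum_prod_type, Pi.mul_apply, spin_mul]
  rw [add_add_add_comm, ← Finset.sum_add_distrib, ← Finset.sum_add_distrib]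
  congr 1
  · refine Finset.sum_congr rfl fun i _ => ?_
    rw [← Finset.sum_add_distrib]
    exact Finset.sum_congr rfl fun j _ => by ring
  · exact Finset.sum_congr rfl fun i _ => by ring

/-- Separating equal from opposite spins leaves a coefficient of the indicator that is nonnegative
when `0 ≤ c`; ferromagnetism enters here. -/
theorem exp_mul_spin_mul_spin (c : ℝ) (s t : ℤˣ) :
    Real.exp (c * (spin s * spin t)) =
      (Real.exp c - Real.exp (-c)) * (if s = t then 1 else 0) + Real.exp (-c) := by
  rcases Int.units_eq_one_or s with rfl | rfl <;> rcases Int.units_eq_one_or t with rfl | rfl <;>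
    simp [spin_one, spin_neg_one, units_ne_neg_self, neg_units_ne_self]

open Classical in
/-- The random-cluster expansion of a product of ferromagnetic pair interactions. -/
theorem prod_exp_eq_sum_edges (c : Fin n × Fin n → ℝ) (ω : Config n) :
    ∏ p : Fin n × Fin n, Real.exp (c p * (spin (ω p.1) * spin (ω p.2))) =
      ∑ η : Finset (Fin n × Fin n), (∏ p ∈ η, (Real.exp (c p) - Real.exp (-c p))) *
        (∏ p ∈ Finset.univ \ η, Real.exp (-c p)) *
        (if ∀ p ∈ η, ω p.1 = ω p.2 then 1 else 0) := by
  simp only [exp_mul_spin_mul_spin]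
  rw [Finset.prod_add, Finset.powerset_univ]
  refine Finset.sum_congr rfl fun η _ => ?_
  rw [Finset.prod_mul_distrib, Finset.prod_boole]
  ring_nf

open Classical in
/-- The inequality for all pairs of configurations with a given quotient `δ`. -/
theorem sum_weight_mul_weight_clusterBox_le (J : Fin n → Fin n → ℝ) (hJ : ∀ i j, 0 ≤ J i j)
    (h : Fin n → ℝ) (δ : Config n) (A B : Set (Config n)) :
    ∑ ω : Config n, weight J h ω * weight J h (δ * ω) *
        (if ω ∈ clusterBox J A B then 1 else 0) ≤
      ∑ ω : Config n, weight J h ω * weight J h (δ * ω) *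
        (if ω ∈ A ∧ δ * ω ∈ B then 1 else 0) := by
  set c : Fin n × Fin n → ℝ := fun p => J p.1 p.2 * (1 + spin (δ p.1) * spin (δ p.2)) with hc
  set g : Config n → ℝ := fun ω => Real.exp (∑ i, h i * (1 + spin (δ i)) * spin (ω i)) with hgdef
  set b : Finset (Fin n × Fin n) → ℝ := fun η => (∏ p ∈ η, (Real.exp (c p) - Real.exp (-c p))) *
    ∏ p ∈ Finset.univ \ η, Real.exp (-c p) with hb
  have expand : ∀ Y : Config n → ℝ,
      ∑ ω : Config n, weight J h ω * weight J h (δ * ω) * Y ω =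
      ∑ η : Finset (Fin n × Fin n), b η *
        ∑ ω : Config n, (if ∀ p ∈ η, ω p.1 = ω p.2 then 1 else 0) * g ω * Y ω := fun Y => by
    simp only [Finset.mul_sum]
    rw [Finset.sum_comm]
    refine Finset.sum_congr rfl fun ω _ => ?_
    rw [weight_mul_weight, prod_exp_eq_sum_edges c ω, Finset.sum_mul, Finset.sum_mul]
    exact Finset.sum_congr rfl fun η _ => by ring
  have hc0 : ∀ p, 0 ≤ c p := fun p => by
    refine mul_nonneg (hJ _ _) ?_
    rcases Int.units_eq_one_or (δ p.1) with h1 | h1 <;>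
      rcases Int.units_eq_one_or (δ p.2) with h2 | h2 <;>
      norm_num [h1, h2, spin_one, spin_neg_one]
  have hcpos : ∀ p, c p ≠ 0 → 0 < J p.1 p.2 ∧ δ p.1 = δ p.2 := fun p hp => by
    refine ⟨(hJ _ _).lt_of_ne' (left_ne_zero_of_mul hp), ?_⟩
    have := right_ne_zero_of_mul hp
    rcases Int.units_eq_one_or (δ p.1) with h1 | h1 <;>
      rcases Int.units_eq_one_or (δ p.2) with h2 | h2 <;>
      simp_all [spin_one, spin_neg_one]
  rw [expand, expand]
  refine Finset.sum_le_sum fun η _ => ?_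
  by_cases hη : ∀ p ∈ η, c p ≠ 0
  · refine mul_le_mul_of_nonneg_left ?_ (mul_nonneg (Finset.prod_nonneg fun p _ => ?_)
      (Finset.prod_nonneg fun p _ => (Real.exp_pos _).le))
    · refine sum_constant_on_edges_le J δ η (fun p hp => (hcpos p (hη p hp)).1)
        (fun p hp => (hcpos p (hη p hp)).2) g (fun ω => (Real.exp_pos _).le)
        (fun ω ω' hωω' => ?_) A B
      refine congrArg Real.exp (Finset.sum_congr rfl fun i _ => ?_)
      by_cases hi : δ i = -1
      · simp [hi, spin_neg_one]
      · rw [hωω' i hi]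
    · exact sub_nonneg.2 (Real.exp_le_exp.2 (by linarith [hc0 p]))
  -- An edge with `c p = 0` contributes the factor `exp 0 - exp 0`, so only edges within a level set
  -- of `δ` survive.
  · push Not at hη
    obtain ⟨p, hp, hp0⟩ := hη
    have : b η = 0 := by
      simp only [hb]
      rw [Finset.prod_eq_zero hp (by simp [hp0]), zero_mul]
    simp [this]

/-! ### Assembly over quotients of pairs -/

theorem prob_eq_div (J : Fin n → Fin n → ℝ) (h : Fin n → ℝ) (A : Set (Config n)) :
    prob J h A = (∑ ω, A.indicator (weight J h) ω) / partitionFunction J h := by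
  classical
  rw [prob, Finset.sum_div]
  refine Finset.sum_congr rfl fun ω _ => ?_
  by_cases hω : ω ∈ A <;> simp [hω, mass]

theorem sum_mul_sum_eq_sum_quotient (F G : Config n → ℝ) :
    (∑ ω, F ω) * ∑ ω, G ω = ∑ δ : Config n, ∑ ω, F ω * G (δ * ω) := by
  rw [Finset.sum_mul_sum]
  conv_rhs => rw [Finset.sum_comm]
  exact Finset.sum_congr rfl fun ω _ =>
    (Equiv.sum_comp (Equiv.mulRight ω) fun ω' => F ω * G ω').symm

end FerromagneticIsing

open FerromagneticIsing in
theorem theorem1p5 (n : ℕ) (J : Fin n → Fin n → ℝ) (hJ : ∀ i j, 0 ≤ J i j) (h : Fin n → ℝ)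
    (A B : Set (FerromagneticIsing.Config n)) :
    FerromagneticIsing.prob J h (FerromagneticIsing.clusterBox J A B) ≤
      FerromagneticIsing.prob J h A * FerromagneticIsing.prob J h B := by
  classical
  have hZ := partitionFunction_pos J h
  rw [prob_eq_div, prob_eq_div, prob_eq_div, div_mul_div_comm, div_le_div_iff₀ hZ (mul_pos hZ hZ),
    ← mul_assoc]
  refine mul_le_mul_of_nonneg_right ?_ hZ.le
  -- The spare `Z` on the left supplies an unconstrained second configuration, so both sides are
  -- sums over pairs.
  rw [partitionFunction, sum_mul_sum_eq_sum_quotient, sum_mul_sum_eq_sum_quotient]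
  refine Finset.sum_le_sum fun δ _ => ?_
  refine Eq.trans_le ?_ ((sum_weight_mul_weight_clusterBox_le J hJ h δ A B).trans_eq ?_)
  · refine Finset.sum_congr rfl fun ω _ => ?_
    by_cases hω : ω ∈ clusterBox J A B <;> simp [hω]
  · refine Finset.sum_congr rfl fun ω _ => ?_
    by_cases hA : ω ∈ A <;> by_cases hB : δ * ω ∈ B <;> simp [hA, hB]
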